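/- Let $n\ge 1$ be an integer. A Blaschke product of degree $n$ is a rational function $B(z)=\alpha\prod_{k=1}^n\frac{z-a_k}{1-\overline{a_k}z}$ with $\alpha,a_1,\dots,a_n\in\mathbb C$, $|\alpha|=1$ and $|a_k|<1$ for all $k$. Put $M(B)=\sup_{|z|=1}|B'(z)|$ and $m(B)=\inf_{|z|=1}|B'(z)|$. (i) For every Blaschke product $B$ of degree $n$ the numbers $M=M(B)$ and $m=m(B)$ satisfy $$\frac{n}{M-n+1}\le m\le n-1+\frac nM\qquad\text{and}\qquad 0<m\le n\le M.$$ (ii) Conversely, for any real numbers $m,M>0$ such that $n$, $m$, $M$ satisfy these inequalities, there exists a Blaschke product $B$ of degree $n$ with $M(B)=M$ and $m(B)=m$. -/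

import Mathlib

/-- The function `z ↦ α * ∏ k, (z - a k) / (1 - conj (a k) * z)`. -/
noncomputable def blaschkeProduct {n : ℕ} (α : ℂ) (a : Fin n → ℂ) (z : ℂ) : ℂ :=
  α * ∏ k, (z - a k) / (1 - (starRingEnd ℂ) (a k) * z)

/-- `B` is a finite Blaschke product of degree `n`: the constant `α` lies on the unit circle and
the `n` zeros (listed with multiplicity) lie in the open unit disk. -/
def IsBlaschkeProduct (n : ℕ) (B : ℂ → ℂ) : Prop :=
  ∃ (α : ℂ) (a : Fin n → ℂ), ‖α‖ = 1 ∧ (∀ k, ‖a k‖ < 1) ∧ B = blaschkeProduct α a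

/-- `M(B)`, the supremum of `|B'|` on the unit circle. -/
noncomputable def supDeriv (B : ℂ → ℂ) : ℝ :=
  sSup ((fun z : ℂ => ‖deriv B z‖) '' Metric.sphere (0 : ℂ) 1)

/-- `m(B)`, the infimum of `|B'|` on the unit circle. -/
noncomputable def infDeriv (B : ℂ → ℂ) : ℝ :=
  sInf ((fun z : ℂ => ‖deriv B z‖) '' Metric.sphere (0 : ℂ) 1)

/-! On the circle `|B'|` is the sum `p` of the Poisson kernels of the zeros, so everything concerns
the extreme values of `p`.

Necessity. The function `z * B z` is a Blaschke product of degree `n + 1` whose derivative has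
modulus `1 + p` on the circle. Each of its fibres over the circle has `n + 1` distinct points there,
and `1 / (1 + p)` sums to 1 over the fibre (`exists_fibre`). Taking the fibre through a maximum or a
minimum point of `p`, and bounding the other `n` terms by `m` or by `M`, gives all four
inequalities.

Sufficiency. For each `M` the two extreme values of `m` are attained by one explicit family built
from Szegő polynomials (`exists_extremal`): `p` equals `(d + 1) / b` at 1 and, for `n = d + 1`,
stays on one side of `d + b`, the side depending on whether `b ≤ 1` or `1 ≤ b`. The two are then
joined inside the level set `M(B) = M`. The zero vectors form the unit ball of the sup norm on `Fin
n → ℂ`. Along each ray `M(B)` increases strictly and continuously from `n` to beyond any bound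
(maximum principle), so for `M > n` the level set is a continuous radial graph over a connected
sphere, and `m(B)` takes every intermediate value on it. -/

open Polynomial ComplexConjugate

/-! ### The derivative on the circle as a sum of Poisson kernels -/

/-- The sum of the Poisson kernels of the points `a k`; on the unit circle it is the modulus of the
derivative of the Blaschke product with zeros `a k`. -/
noncomputable def poissonSum {n : ℕ} (a : Fin n → ℂ) (z : ℂ) : ℝ :=
  ∑ k, (1 - ‖a k‖ ^ 2) / ‖z - a k‖ ^ 2

lemma mul_conj_eq_one {z : ℂ} (hz : ‖z‖ = 1) : z * conj z = 1 := by
  rw [Complex.mul_conj, Complex.normSq_eq_norm_sq, hz]; norm_num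

lemma ne_zero_of_norm_eq_one {z : ℂ} (hz : ‖z‖ = 1) : z ≠ 0 := by
  rintro rfl; simp at hz

lemma sub_ne_zero_of_norm {a z : ℂ} (ha : ‖a‖ < 1) (hz : 1 ≤ ‖z‖) : z - a ≠ 0 := by
  intro h
  rw [sub_eq_zero.1 h] at hz
  linarith

lemma one_sub_conj_mul_ne_zero {a z : ℂ} (ha : ‖a‖ < 1) (hz : ‖z‖ ≤ 1) : 1 - conj a * z ≠ 0 := by
  intro h
  have h1 : ‖conj a * z‖ = 1 := by rw [← sub_eq_zero.1 h]; simp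
  rw [norm_mul, Complex.norm_conj] at h1
  nlinarith [norm_nonneg a, norm_nonneg z]

lemma ofReal_norm_sq (z : ℂ) : ((‖z‖ ^ 2 : ℝ) : ℂ) = z * conj z := by
  rw [Complex.mul_conj, Complex.normSq_eq_norm_sq]

/-- The right side is `z` times the logarithmic derivative of one Blaschke factor. -/
lemma poissonKernel_eq {a z : ℂ} (ha : ‖a‖ < 1) (hz : ‖z‖ = 1) :
    (((1 - ‖a‖ ^ 2) / ‖z - a‖ ^ 2 : ℝ) : ℂ) = z * (1 / (z - a) + conj a / (1 - conj a * z)) := by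
  have h1 := sub_ne_zero_of_norm ha hz.ge
  have h2 := one_sub_conj_mul_ne_zero ha hz.le
  have h3 := mul_conj_eq_one hz
  have h4 : conj z - conj a ≠ 0 := by
    rw [← map_sub]; exact (_root_.map_ne_zero _).2 h1
  rw [Complex.ofReal_div, Complex.ofReal_sub, ofReal_norm_sq, ofReal_norm_sq, map_sub,
    Complex.ofReal_one]
  field_simp
  linear_combination (-(1 - a * conj a)) * h3

lemma poissonSum_nonneg {n : ℕ} {a : Fin n → ℂ} (ha : ∀ k, ‖a k‖ < 1) (z : ℂ) :
    0 ≤ poissonSum a z := by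
  refine Finset.sum_nonneg fun k _ => div_nonneg ?_ (sq_nonneg _)
  nlinarith [ha k, norm_nonneg (a k)]

lemma poissonSum_pos {n : ℕ} (hn : 1 ≤ n) {a : Fin n → ℂ} (ha : ∀ k, ‖a k‖ < 1) {z : ℂ}
    (hz : ‖z‖ = 1) : 0 < poissonSum a z := by
  refine Finset.sum_pos (fun k _ => div_pos ?_ ?_) ⟨⟨0, hn⟩, Finset.mem_univ _⟩
  · nlinarith [ha k, norm_nonneg (a k)]
  · have := norm_pos_iff.2 (sub_ne_zero_of_norm (ha k) hz.ge)
    positivity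

lemma poissonSum_eq {n : ℕ} {a : Fin n → ℂ} (ha : ∀ k, ‖a k‖ < 1) {z : ℂ} (hz : ‖z‖ = 1) :
    (poissonSum a z : ℂ) =
      z * (∑ k, 1 / (z - a k) + ∑ k, conj (a k) / (1 - conj (a k) * z)) := by
  rw [poissonSum, Complex.ofReal_sum, ← Finset.sum_add_distrib, Finset.mul_sum]
  exact Finset.sum_congr rfl fun k _ => poissonKernel_eq (ha k) hz

lemma logDeriv_prod_sub {n : ℕ} {a : Fin n → ℂ} {z : ℂ} (h : ∀ k, z - a k ≠ 0) :
    logDeriv (fun z => ∏ k, (z - a k)) z = ∑ k, 1 / (z - a k) := by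
  rw [logDeriv_prod (fun k _ => h k) (fun k _ => by fun_prop)]
  refine Finset.sum_congr rfl fun k _ => ?_
  simp [logDeriv_apply]

lemma logDeriv_prod_one_sub {n : ℕ} {a : Fin n → ℂ} {z : ℂ} (h : ∀ k, 1 - conj (a k) * z ≠ 0) :
    logDeriv (fun z => ∏ k, (1 - conj (a k) * z)) z =
      -∑ k, conj (a k) / (1 - conj (a k) * z) := by
  rw [logDeriv_prod (fun k _ => h k) (fun k _ => by fun_prop), ← Finset.sum_neg_distrib]
  refine Finset.sum_congr rfl fun k _ => ?_
  rw [logDeriv_apply, deriv_const_sub, deriv_const_mul_field, deriv_id'']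
  ring

lemma norm_one_sub_conj_mul {a z : ℂ} (hz : ‖z‖ = 1) : ‖1 - conj a * z‖ = ‖z - a‖ := by
  have : 1 - conj a * z = z * conj (z - a) := by
    rw [map_sub]
    linear_combination -mul_conj_eq_one hz
  rw [this, norm_mul, hz, one_mul, Complex.norm_conj]

/-- Since `|B| = |z| = 1`, the modulus of `B'` is that of `z * B' / B`, which is already real and
nonnegative. -/
lemma norm_deriv_blaschkeProduct {n : ℕ} {α : ℂ} {a : Fin n → ℂ} (hα : ‖α‖ = 1)
    (ha : ∀ k, ‖a k‖ < 1) {z : ℂ} (hz : ‖z‖ = 1) :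
    ‖deriv (blaschkeProduct α a) z‖ = poissonSum a z := by
  have h1 k := sub_ne_zero_of_norm (ha k) hz.ge
  have h2 k := one_sub_conj_mul_ne_zero (ha k) hz.le
  have hα0 := ne_zero_of_norm_eq_one hα
  have hP : ∏ k, (z - a k) ≠ 0 := Finset.prod_ne_zero_iff.2 fun k _ => h1 k
  have hQ : ∏ k, (1 - conj (a k) * z) ≠ 0 := Finset.prod_ne_zero_iff.2 fun k _ => h2 k
  have hB : blaschkeProduct α a =
      fun z => α * ((∏ k, (z - a k)) / ∏ k, (1 - conj (a k) * z)) := by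
    ext z
    rw [blaschkeProduct, Finset.prod_div_distrib]
  have hnorm : ‖blaschkeProduct α a z‖ = 1 := by
    rw [hB]
    simp only [norm_mul, norm_div, norm_prod, norm_one_sub_conj_mul hz, hα, one_mul]
    refine div_self (Finset.prod_ne_zero_iff.2 fun k _ => norm_ne_zero_iff.2 (h1 k))
  have hlog : z * logDeriv (blaschkeProduct α a) z = poissonSum a z := by
    rw [hB, logDeriv_const_mul _ _ hα0,
      logDeriv_div (f := fun z => ∏ k, (z - a k))
        (g := fun z => ∏ k, (1 - conj (a k) * z)) _ hP hQ (by fun_prop) (by fun_prop), logDeriv_prod_sub h1,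
      logDeriv_prod_one_sub h2, poissonSum_eq ha hz]
    ring
  have := congrArg norm hlog
  rw [norm_mul, hz, one_mul, logDeriv_apply, norm_div, hnorm, div_one, Complex.norm_real,
    Real.norm_of_nonneg (poissonSum_nonneg ha z)] at this
  exact this

/-! ### The fibre identity -/

lemma norm_one_sub_conj_mul_sq_sub (a z : ℂ) :
    ‖1 - conj a * z‖ ^ 2 - ‖z - a‖ ^ 2 = (1 - ‖a‖ ^ 2) * (1 - ‖z‖ ^ 2) := by
  have : ((‖1 - conj a * z‖ ^ 2 - ‖z - a‖ ^ 2 : ℝ) : ℂ) =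
      (((1 - ‖a‖ ^ 2) * (1 - ‖z‖ ^ 2) : ℝ) : ℂ) := by
    rw [Complex.ofReal_sub, Complex.ofReal_mul, Complex.ofReal_sub, Complex.ofReal_sub]
    simp only [ofReal_norm_sq, map_sub, map_mul, map_one, Complex.conj_conj, Complex.ofReal_one]
    ring
  exact_mod_cast this

lemma norm_le_one_sub_conj_mul {a z : ℂ} (ha : ‖a‖ < 1) (hz : ‖z‖ ≤ 1) :
    ‖z - a‖ ≤ ‖1 - conj a * z‖ := by
  have h1 : 0 ≤ 1 - ‖a‖ ^ 2 := by nlinarith [norm_nonneg a]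
  have h2 : 0 ≤ 1 - ‖z‖ ^ 2 := by nlinarith [norm_nonneg z]
  refine (sq_le_sq₀ (norm_nonneg _) (norm_nonneg _)).1 ?_
  linarith [norm_one_sub_conj_mul_sq_sub a z, mul_nonneg h1 h2]

lemma norm_one_sub_conj_mul_le {a z : ℂ} (ha : ‖a‖ < 1) (hz : 1 ≤ ‖z‖) :
    ‖1 - conj a * z‖ ≤ ‖z - a‖ := by
  have h1 : 0 ≤ 1 - ‖a‖ ^ 2 := by nlinarith [norm_nonneg a]
  have h2 : 0 ≤ ‖z‖ ^ 2 - 1 := by nlinarith [norm_nonneg z]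
  refine (sq_le_sq₀ (norm_nonneg _) (norm_nonneg _)).1 ?_
  linarith [norm_one_sub_conj_mul_sq_sub a z, mul_nonneg h1 h2]

/-- The fibre of `z * B z` through a point of the unit circle, where `B` is the Blaschke product
with zeros `a k`. -/
lemma exists_fibre {n : ℕ} {a : Fin n → ℂ} (ha : ∀ k, ‖a k‖ < 1) {w : ℂ} (hw : ‖w‖ = 1) :
    ∃ s : Finset ℂ, s.card = n + 1 ∧ w ∈ s ∧ (∀ z ∈ s, ‖z‖ = 1) ∧
      ∑ z ∈ s, 1 / (1 + poissonSum a z) = 1 := by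
  classical
  set P : ℂ[X] := X * ∏ k, (X - C (a k)) with hP
  set Q : ℂ[X] := ∏ k, (1 - C (conj (a k)) * X) with hQ
  have evP z : P.eval z = z * ∏ k, (z - a k) := by simp [hP, eval_prod]
  have evQ z : Q.eval z = ∏ k, (1 - conj (a k) * z) := by simp [hQ, eval_prod]
  have Qne {z : ℂ} (hz : ‖z‖ ≤ 1) : Q.eval z ≠ 0 := by
    rw [evQ]
    exact Finset.prod_ne_zero_iff.2 fun k _ => one_sub_conj_mul_ne_zero (ha k) hz
  have normPQ {z : ℂ} (hz : ‖z‖ = 1) : ‖P.eval z‖ = ‖Q.eval z‖ := by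
    simp only [evP, evQ, norm_mul, norm_prod, norm_one_sub_conj_mul hz, hz, one_mul]
  -- With `P / Q = z * B z` and `c` its value at `w`, the roots of `P - c Q` are the fibre through
  -- `w`.
  set c : ℂ := P.eval w / Q.eval w with hc
  have hc1 : ‖c‖ = 1 := by
    rw [hc, norm_div, normPQ hw, div_self (norm_ne_zero_iff.2 (Qne hw.le))]
  have hc0 := ne_zero_of_norm_eq_one hc1
  set R : ℂ[X] := P - C c * Q with hR
  have degP : P.degree = (n + 1 : ℕ) := by
    rw [hP, degree_mul, degree_prod]
    simp [add_comm]
  have monP : P.Monic := monic_X.mul (monic_prod_of_monic _ _ fun k _ => monic_X_sub_C _)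
  have degQ : Q.degree < (n + 1 : ℕ) := by
    rw [hQ, degree_prod]
    refine lt_of_le_of_lt (Finset.sum_le_sum (g := fun _ => (1 : WithBot ℕ)) fun k _ => ?_) ?_
    · exact (degree_sub_le _ _).trans (max_le (by simp) (degree_C_mul_X_le _))
    · simp only [Finset.sum_const, Finset.card_univ, Fintype.card_fin, nsmul_eq_mul, mul_one]
      exact_mod_cast Nat.lt_succ_self n
  have degcQ : (C c * Q).degree < P.degree := by
    rw [degree_C_mul hc0, degP]; exact degQ
  have monR : R.Monic := monP.sub_of_left degcQ
  have degR : R.natDegree = n + 1 :=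
    natDegree_eq_of_degree_eq_some (by rw [hR, degree_sub_eq_left_of_degree_lt degcQ, degP])
  have root_norm {z : ℂ} (hz : R.IsRoot z) : ‖z‖ = 1 := by
    have h : z * ∏ k, (z - a k) = c * ∏ k, (1 - conj (a k) * z) := by
      have : P.eval z - c * Q.eval z = 0 := by simpa [hR] using hz
      rwa [evP, evQ, sub_eq_zero] at this
    have h' := congrArg norm h
    simp only [norm_mul, norm_prod, hc1, one_mul] at h'
    -- `z * B z` has modulus below 1 inside the disk and above 1 outside, so it can equal `c` only
    -- on the circle.
    rcases lt_trichotomy ‖z‖ 1 with hlt | heq | hgt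
    · exfalso
      have h1 : ∏ k, ‖z - a k‖ ≤ ∏ k, ‖1 - conj (a k) * z‖ :=
        Finset.prod_le_prod (fun k _ => norm_nonneg _)
          fun k _ => norm_le_one_sub_conj_mul (ha k) hlt.le
      have h2 : 0 < ∏ k, ‖1 - conj (a k) * z‖ := Finset.prod_pos fun k _ =>
        norm_pos_iff.2 (one_sub_conj_mul_ne_zero (ha k) hlt.le)
      nlinarith [norm_nonneg z]
    · exact heq
    · exfalso
      have h1 : ∏ k, ‖1 - conj (a k) * z‖ ≤ ∏ k, ‖z - a k‖ :=
        Finset.prod_le_prod (fun k _ => norm_nonneg _)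
          fun k _ => norm_one_sub_conj_mul_le (ha k) hgt.le
      have h2 : 0 < ∏ k, ‖z - a k‖ := Finset.prod_pos fun k _ =>
        norm_pos_iff.2 (sub_ne_zero_of_norm (ha k) hgt.le)
      nlinarith
  have deriv_root {z : ℂ} (hz : R.IsRoot z) :
      z * (derivative R).eval z = c * Q.eval z * (1 + poissonSum a z : ℝ) := by
    have hz1 := root_norm hz
    have hz0 := ne_zero_of_norm_eq_one hz1
    have h1 k := sub_ne_zero_of_norm (ha k) hz1.ge
    have h2 k := one_sub_conj_mul_ne_zero (ha k) hz1.le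
    have hPQ : P.eval z = c * Q.eval z := by
      have : P.eval z - c * Q.eval z = 0 := by simpa [hR] using hz
      rwa [sub_eq_zero] at this
    have hp0 : ∏ k, (z - a k) ≠ 0 := Finset.prod_ne_zero_iff.2 fun k _ => h1 k
    have hP0 : P.eval z ≠ 0 := by rw [evP]; exact mul_ne_zero hz0 hp0
    have hQ0 := Qne hz1.le
    have dP : (derivative P).eval z = P.eval z * (1 / z + ∑ k, 1 / (z - a k)) := by
      rw [← logDeriv_prod_sub h1, ← logDeriv_id z, ← logDeriv_mul z (f := id) hz0 hp0
        (by fun_prop) (by fun_prop)]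
      have : (fun z : ℂ => id z * ∏ k, (z - a k)) = fun z => P.eval z := by ext; simp [evP]
      rw [this, logDeriv_apply, Polynomial.deriv]
      field_simp
    have dQ : (derivative Q).eval z =
        -(Q.eval z * ∑ k, conj (a k) / (1 - conj (a k) * z)) := by
      rw [← mul_neg, ← logDeriv_prod_one_sub h2]
      have : (fun z : ℂ => ∏ k, (1 - conj (a k) * z)) = fun z => Q.eval z := by ext; simp [evQ]
      rw [this, logDeriv_apply, Polynomial.deriv]
      field_simp
    rw [Complex.ofReal_add, Complex.ofReal_one, poissonSum_eq ha hz1, hR]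
    simp only [derivative_sub, derivative_C_mul, eval_sub, eval_mul, eval_C, dP, dQ, hPQ]
    field_simp
    ring
  have wroot : R.IsRoot w := by
    have := Qne hw.le
    simp only [hR, IsRoot, eval_sub, eval_mul, eval_C, hc]
    field_simp
    ring
  have pos {z : ℂ} : 0 < 1 + poissonSum a z := by linarith [poissonSum_nonneg ha z]
  have R0 := monR.ne_zero
  -- The roots are simple: at a root, `z * R'` is `c * Q` times `1 + p`, which is positive.
  have nodup : R.roots.Nodup := by
    rw [Multiset.nodup_iff_count_le_one]
    intro z
    rw [count_roots]
    by_contra! h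
    obtain ⟨hz, hz'⟩ := (one_lt_rootMultiplicity_iff_isRoot R0).1 h
    have := deriv_root hz
    rw [hz', mul_zero] at this
    refine mul_ne_zero (mul_ne_zero hc0 (Qne (root_norm hz).le)) ?_ this.symm
    exact_mod_cast pos.ne'
  have hspl : R.Splits := IsAlgClosed.splits R
  have hcard : R.roots.toFinset.card = n + 1 := by
    rw [Multiset.toFinset_card_of_nodup nodup, ← degR]
    exact hspl.natDegree_eq_card_roots.symm
  have hnodal : Lagrange.nodal R.roots.toFinset id = R := by
    conv_rhs => rw [hspl.eq_prod_roots, monR.leadingCoeff, C_1, one_mul]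
    rw [Lagrange.nodal_eq, Finset.prod, Multiset.toFinset_val, nodup.dedup]
    rfl
  have mem {z : ℂ} : z ∈ R.roots.toFinset ↔ R.IsRoot z := by
    rw [Multiset.mem_toFinset, mem_roots R0]
  refine ⟨R.roots.toFinset, hcard, mem.2 wroot, fun z hz => root_norm (mem.1 hz), ?_⟩
  -- `Q` has degree at most `n`, so it equals its interpolant at the `n + 1` roots of `R`.
  -- Evaluating at 0, where `Q = 1` and `R = -c`, and inserting the formula for `z * R'` gives the
  -- identity.
  have hQi := Lagrange.eq_interpolate (s := R.roots.toFinset) (v := id) (f := Q)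
    Function.injective_id.injOn (by rw [hcard]; exact degQ)
  have h0 := congrArg (eval 0) hQi
  rw [Lagrange.eval_interpolate_not_at_node _ (fun z hz => by
    have := ne_zero_of_norm_eq_one (root_norm (mem.1 hz)); exact this.symm), hnodal] at h0
  have e1 : Q.eval 0 = 1 := by simp [evQ]
  have e2 : R.eval 0 = -c := by simp [hR, evP, e1]
  rw [e1, e2, Finset.mul_sum] at h0
  have : ((∑ z ∈ R.roots.toFinset, 1 / (1 + poissonSum a z) : ℝ) : ℂ) = (1 : ℝ) := by
    rw [Complex.ofReal_one, h0, Complex.ofReal_sum]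
    refine Finset.sum_congr rfl fun z hz => ?_
    rw [Lagrange.nodalWeight_eq_eval_derivative_nodal hz, hnodal]
    have hz' := mem.1 hz
    have hd := deriv_root hz'
    have hz0 := ne_zero_of_norm_eq_one (root_norm hz')
    have hQ0 := Qne (root_norm hz').le
    have hp : ((1 + poissonSum a z : ℝ) : ℂ) ≠ 0 := by exact_mod_cast pos.ne'
    have hR' : (derivative R).eval z ≠ 0 := by
      intro h
      rw [h, mul_zero] at hd
      exact mul_ne_zero (mul_ne_zero hc0 hQ0) hp hd.symm
    rw [Complex.ofReal_div, Complex.ofReal_one]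
    simp only [id, zero_sub]
    field_simp
    linear_combination hd
  exact_mod_cast this

/-- Apart from `w` itself the fibre has `n` points, each contributing at least `1 / (1 + M)`. -/
lemma div_one_add_le_of_fibre {n : ℕ} {a : Fin n → ℂ} (ha : ∀ k, ‖a k‖ < 1) {M : ℝ}
    (hM : ∀ z : ℂ, ‖z‖ = 1 → poissonSum a z ≤ M) {w : ℂ} (hw : ‖w‖ = 1) :
    n / (1 + M) ≤ poissonSum a w / (1 + poissonSum a w) := by
  classical
  obtain ⟨s, hs, hws, hs1, hsum⟩ := exists_fibre ha hw
  have hw0 := poissonSum_nonneg ha w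
  have h : (n : ℝ) * (1 / (1 + M)) ≤ ∑ z ∈ s.erase w, 1 / (1 + poissonSum a z) := by
    have := Finset.card_nsmul_le_sum (s.erase w) (fun z => 1 / (1 + poissonSum a z)) (1 / (1 + M))
      fun z hz => one_div_le_one_div_of_le (by linarith [poissonSum_nonneg ha z])
        (by linarith [hM z (hs1 z (Finset.mem_of_mem_erase hz))])
    rwa [Finset.card_erase_of_mem hws, hs, nsmul_eq_mul, Nat.add_sub_cancel] at this
  rw [← Finset.add_sum_erase s _ hws] at hsum
  have e : poissonSum a w / (1 + poissonSum a w) = 1 - 1 / (1 + poissonSum a w) := by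
    field_simp
    ring
  rw [e, div_eq_mul_one_div (n : ℝ)]
  linarith

lemma le_div_one_add_of_fibre {n : ℕ} {a : Fin n → ℂ} (ha : ∀ k, ‖a k‖ < 1) {m : ℝ} (hm0 : 0 ≤ m)
    (hm : ∀ z : ℂ, ‖z‖ = 1 → m ≤ poissonSum a z) {w : ℂ} (hw : ‖w‖ = 1) :
    poissonSum a w / (1 + poissonSum a w) ≤ n / (1 + m) := by
  classical
  obtain ⟨s, hs, hws, hs1, hsum⟩ := exists_fibre ha hw
  have hw0 := poissonSum_nonneg ha w
  have h : ∑ z ∈ s.erase w, 1 / (1 + poissonSum a z) ≤ (n : ℝ) * (1 / (1 + m)) := by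
    have := Finset.sum_le_card_nsmul (s.erase w) (fun z => 1 / (1 + poissonSum a z)) (1 / (1 + m))
      fun z hz => one_div_le_one_div_of_le (by linarith)
        (by linarith [hm z (hs1 z (Finset.mem_of_mem_erase hz))])
    rwa [Finset.card_erase_of_mem hws, hs, nsmul_eq_mul, Nat.add_sub_cancel] at this
  rw [← Finset.add_sum_erase s _ hws] at hsum
  have e : poissonSum a w / (1 + poissonSum a w) = 1 - 1 / (1 + poissonSum a w) := by
    field_simp
    ring
  rw [e, div_eq_mul_one_div (n : ℝ)]
  linarith

/-! ### Extreme values on the circle and the necessary inequalities -/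

open Polynomial ComplexConjugate

/-- Supremum of `poissonSum a` over the unit circle. -/
noncomputable def poissonSup {n : ℕ} (a : Fin n → ℂ) : ℝ :=
  sSup (poissonSum a '' Metric.sphere (0 : ℂ) 1)

/-- Infimum of `poissonSum a` over the unit circle. -/
noncomputable def poissonInf {n : ℕ} (a : Fin n → ℂ) : ℝ :=
  sInf (poissonSum a '' Metric.sphere (0 : ℂ) 1)

section

variable {n : ℕ} {a : Fin n → ℂ}

lemma image_norm_deriv_blaschkeProduct {α : ℂ} (hα : ‖α‖ = 1) (ha : ∀ k, ‖a k‖ < 1) :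
    (fun z : ℂ => ‖deriv (blaschkeProduct α a) z‖) '' Metric.sphere (0 : ℂ) 1 =
      poissonSum a '' Metric.sphere (0 : ℂ) 1 :=
  Set.image_congr fun _ hz => norm_deriv_blaschkeProduct hα ha (mem_sphere_zero_iff_norm.1 hz)

lemma supDeriv_blaschkeProduct {α : ℂ} (hα : ‖α‖ = 1) (ha : ∀ k, ‖a k‖ < 1) :
    supDeriv (blaschkeProduct α a) = poissonSup a := by
  rw [supDeriv, poissonSup, image_norm_deriv_blaschkeProduct hα ha]

lemma infDeriv_blaschkeProduct {α : ℂ} (hα : ‖α‖ = 1) (ha : ∀ k, ‖a k‖ < 1) :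
    infDeriv (blaschkeProduct α a) = poissonInf a := by
  rw [infDeriv, poissonInf, image_norm_deriv_blaschkeProduct hα ha]

lemma continuousOn_poissonSum (ha : ∀ k, ‖a k‖ < 1) :
    ContinuousOn (poissonSum a) (Metric.sphere (0 : ℂ) 1) := by
  unfold poissonSum
  refine continuousOn_finsetSum _ fun k _ => ContinuousOn.div (by fun_prop) (by fun_prop) ?_
  intro z hz
  have := norm_ne_zero_iff.2 (sub_ne_zero_of_norm (ha k) (mem_sphere_zero_iff_norm.1 hz).ge)
  positivity

lemma sphere_nonempty_complex : (Metric.sphere (0 : ℂ) 1).Nonempty :=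
  ⟨1, by simp⟩

lemma poissonSum_le_poissonSup (ha : ∀ k, ‖a k‖ < 1) {z : ℂ} (hz : ‖z‖ = 1) :
    poissonSum a z ≤ poissonSup a :=
  le_csSup ((isCompact_sphere 0 1).image_of_continuousOn (continuousOn_poissonSum ha)).bddAbove
    (Set.mem_image_of_mem _ (mem_sphere_zero_iff_norm.2 hz))

lemma poissonInf_le_poissonSum (ha : ∀ k, ‖a k‖ < 1) {z : ℂ} (hz : ‖z‖ = 1) :
    poissonInf a ≤ poissonSum a z :=
  csInf_le ((isCompact_sphere 0 1).image_of_continuousOn (continuousOn_poissonSum ha)).bddBelow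
    (Set.mem_image_of_mem _ (mem_sphere_zero_iff_norm.2 hz))

lemma exists_poissonSum_eq_poissonSup (ha : ∀ k, ‖a k‖ < 1) :
    ∃ z : ℂ, ‖z‖ = 1 ∧ poissonSum a z = poissonSup a := by
  obtain ⟨z, hz, h⟩ := ((isCompact_sphere 0 1).image_of_continuousOn
    (continuousOn_poissonSum ha)).sSup_mem (sphere_nonempty_complex.image _)
  exact ⟨z, mem_sphere_zero_iff_norm.1 hz, h⟩

lemma exists_poissonSum_eq_poissonInf (ha : ∀ k, ‖a k‖ < 1) :
    ∃ z : ℂ, ‖z‖ = 1 ∧ poissonSum a z = poissonInf a := by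
  obtain ⟨z, hz, h⟩ := ((isCompact_sphere 0 1).image_of_continuousOn
    (continuousOn_poissonSum ha)).sInf_mem (sphere_nonempty_complex.image _)
  exact ⟨z, mem_sphere_zero_iff_norm.1 hz, h⟩

lemma poissonSup_le {M : ℝ} (h : ∀ z : ℂ, ‖z‖ = 1 → poissonSum a z ≤ M) : poissonSup a ≤ M := by
  refine csSup_le (sphere_nonempty_complex.image _) ?_
  rintro _ ⟨z, hz, rfl⟩
  exact h z (mem_sphere_zero_iff_norm.1 hz)

lemma le_poissonInf {m : ℝ} (h : ∀ z : ℂ, ‖z‖ = 1 → m ≤ poissonSum a z) : m ≤ poissonInf a := by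
  refine le_csInf (sphere_nonempty_complex.image _) ?_
  rintro _ ⟨z, hz, rfl⟩
  exact h z (mem_sphere_zero_iff_norm.1 hz)

lemma poissonInf_pos (hn : 1 ≤ n) (ha : ∀ k, ‖a k‖ < 1) : 0 < poissonInf a := by
  obtain ⟨z, hz, h⟩ := exists_poissonSum_eq_poissonInf ha
  exact h ▸ poissonSum_pos hn ha hz

lemma poissonInf_nonneg (ha : ∀ k, ‖a k‖ < 1) : 0 ≤ poissonInf a :=
  le_poissonInf fun z _ => poissonSum_nonneg ha z

lemma poissonSup_nonneg (ha : ∀ k, ‖a k‖ < 1) : 0 ≤ poissonSup a := by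
  obtain ⟨z, -, h⟩ := exists_poissonSum_eq_poissonSup ha
  exact h ▸ poissonSum_nonneg ha z

lemma natCast_le_poissonSup (ha : ∀ k, ‖a k‖ < 1) : (n : ℝ) ≤ poissonSup a := by
  obtain ⟨w, hw, h⟩ := exists_poissonSum_eq_poissonSup ha
  have h0 := poissonSup_nonneg ha
  have := div_one_add_le_of_fibre ha (fun z hz => poissonSum_le_poissonSup ha hz) hw
  rw [h, div_le_div_iff_of_pos_right (by linarith)] at this
  exact this

lemma poissonInf_le_natCast (ha : ∀ k, ‖a k‖ < 1) : poissonInf a ≤ n := by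
  obtain ⟨w, hw, h⟩ := exists_poissonSum_eq_poissonInf ha
  have h0 := poissonInf_nonneg ha
  have := le_div_one_add_of_fibre ha h0 (fun z hz => poissonInf_le_poissonSum ha hz) hw
  rw [h, div_le_div_iff_of_pos_right (by linarith)] at this
  exact this

lemma natCast_le_poissonInf_mul (ha : ∀ k, ‖a k‖ < 1) :
    (n : ℝ) ≤ poissonInf a * (poissonSup a - n + 1) := by
  obtain ⟨w, hw, h⟩ := exists_poissonSum_eq_poissonInf ha
  have h0 := poissonInf_nonneg ha
  have h1 := poissonSup_nonneg ha
  have := div_one_add_le_of_fibre ha (fun z hz => poissonSum_le_poissonSup ha hz) hw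
  rw [h, div_le_div_iff₀ (by linarith) (by linarith)] at this
  linarith

lemma poissonSup_mul_le_natCast (ha : ∀ k, ‖a k‖ < 1) :
    poissonSup a * (poissonInf a - n + 1) ≤ n := by
  obtain ⟨w, hw, h⟩ := exists_poissonSum_eq_poissonSup ha
  have h0 := poissonInf_nonneg ha
  have h1 := poissonSup_nonneg ha
  have := le_div_one_add_of_fibre ha h0 (fun z hz => poissonInf_le_poissonSum ha hz) hw
  rw [h, div_le_div_iff₀ (by linarith) (by linarith)] at this
  linarith

end

/-! ### Szegő polynomials and the zeros of the extremal polynomial -/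

open Polynomial ComplexConjugate

/-- The pair of the circle polynomial of degree `d` for the weight `|1 - z| ^ (2 * b)` and its
reverse, generated by the Szegő recursion. -/
noncomputable def szegoPair (b : ℝ) : ℕ → ℂ[X] × ℂ[X]
  | 0 => (1, 1)
  | d + 1 =>
    (C ((d + 1 : ℂ)⁻¹) * (C (b + (d + 1) : ℂ) * X * (szegoPair b d).1 + C (b : ℂ) * (szegoPair b d).2),
      C ((d + 1 : ℂ)⁻¹) *
        (C (b + (d + 1) : ℂ) * (szegoPair b d).2 + C (b : ℂ) * X * (szegoPair b d).1))

/-- Up to a constant, the numerator of the extremal Blaschke product of degree `d + 1`. -/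
noncomputable def extremalPoly (b : ℝ) (d : ℕ) : ℂ[X] :=
  (C (b + (d + 1) : ℂ) * X - C (d + 1 : ℂ)) * (szegoPair b d).1 + C (b : ℂ) * (szegoPair b d).2

section

variable {b : ℝ}

/-- Two first-order differential relations preserved by the recursion. Solved for the derivatives,
with factor `1 - z`, they eliminate derivatives from the Poisson sum. -/
lemma szegoPair_relations (b : ℝ) (d : ℕ) (z : ℂ) :
    z * (derivative (szegoPair b d).1).eval z + z * (derivative (szegoPair b d).2).eval z =
        (b + d) * (szegoPair b d).1.eval z - b * (szegoPair b d).2.eval z ∧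
      (derivative (szegoPair b d).2).eval z =
        d * (szegoPair b d).1.eval z - z * (derivative (szegoPair b d).1).eval z := by
  induction d with
  | zero => simp [szegoPair]
  | succ d ih =>
    obtain ⟨h1, h2⟩ := ih
    simp only [szegoPair, derivative_mul, derivative_add, derivative_C, derivative_X, eval_mul,
      eval_add, eval_C, eval_X, zero_mul, mul_one, zero_add]
    push_cast
    set x := (szegoPair b d).1.eval z
    set y := (szegoPair b d).2.eval z
    set x' := (derivative (szegoPair b d).1).eval z
    set y' := (derivative (szegoPair b d).2).eval z
    constructor
    · linear_combination (d + 1 : ℂ)⁻¹ * (b + (d + 1) + b) * z * h2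
    · linear_combination (d + 1 : ℂ)⁻¹ *
        ((b + (d + 1)) * z * h2 + b * h1 + (b + (d + 1)) * h2 - (b + (d + 1)) * h1)

lemma eval_szegoPair_snd (b : ℝ) (d : ℕ) {z : ℂ} (hz : ‖z‖ = 1) :
    (szegoPair b d).2.eval z = z ^ d * conj ((szegoPair b d).1.eval z) ∧
    (szegoPair b d).1.eval z = z ^ d * conj ((szegoPair b d).2.eval z) := by
  have hzz := mul_conj_eq_one hz
  induction d with
  | zero => simp [szegoPair]
  | succ d ih =>
    obtain ⟨h1, h2⟩ := ih
    simp only [szegoPair, eval_mul, eval_add, eval_C, eval_X]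
    simp only [map_mul, map_add, map_inv₀, map_one, map_natCast, Complex.conj_ofReal]
    set x := (szegoPair b d).1.eval z
    set y := (szegoPair b d).2.eval z
    constructor
    · linear_combination (d + 1 : ℂ)⁻¹ * ((b + (d + 1)) * h1 + b * z * h2
        - (b + (d + 1)) * z ^ d * conj x * hzz)
    · linear_combination (d + 1 : ℂ)⁻¹ * ((b + (d + 1)) * z * h2 + b * h1
        - b * z ^ d * conj x * hzz)

lemma norm_add_natCast (hb : 0 < b) (d : ℕ) : ‖((b : ℂ) + (d + 1))‖ = b + (d + 1) := by
  have : ((b : ℂ) + (d + 1)) = ((b + (d + 1) : ℝ) : ℂ) := by push_cast; ring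
  rw [this, Complex.norm_real, Real.norm_of_nonneg (by positivity)]

lemma norm_eval_szegoPair (hb : 0 < b) (d : ℕ) {z : ℂ} (hz : 1 ≤ ‖z‖) :
    ‖(szegoPair b d).2.eval z‖ ≤ ‖(szegoPair b d).1.eval z‖ ∧ (szegoPair b d).1.eval z ≠ 0 := by
  induction d with
  | zero => simp [szegoPair]
  | succ d ih =>
    obtain ⟨h1, h2⟩ := ih
    have hd : 0 < (d + 1 : ℝ) := by positivity
    simp only [szegoPair, eval_mul, eval_add, eval_C, eval_X]
    set x := (szegoPair b d).1.eval z
    set y := (szegoPair b d).2.eval z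
    have hx := norm_pos_iff.2 h2
    have hxy : ‖y‖ ≤ ‖z * x‖ := by
      rw [norm_mul]; nlinarith
    have hzx : ‖x‖ ≤ ‖z * x‖ := by
      rw [norm_mul]; nlinarith
    -- One recursion step multiplies the gap of squared norms by a positive constant; it is applied
    -- to `z * x` and `y`.
    have key : ∀ p q : ℂ, ‖((b : ℂ) + (d + 1)) * p + b * q‖ ^ 2 - ‖((b : ℂ) + (d + 1)) * q + b * p‖ ^ 2 =
        ((b + (d + 1)) ^ 2 - b ^ 2) * (‖p‖ ^ 2 - ‖q‖ ^ 2) := by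
      intro p q
      apply Complex.ofReal_injective
      rw [Complex.ofReal_sub, Complex.ofReal_mul, Complex.ofReal_sub, Complex.ofReal_sub]
      simp only [ofReal_norm_sq, map_add, map_mul, Complex.conj_ofReal, map_natCast, map_one]
      push_cast
      ring
    constructor
    · rw [norm_mul, norm_mul]
      refine mul_le_mul_of_nonneg_left ?_ (norm_nonneg _)
      refine (sq_le_sq₀ (norm_nonneg _) (norm_nonneg _)).1 ?_
      have h3 : 0 ≤ (b + (d + 1)) ^ 2 - b ^ 2 := by nlinarith
      have h4 : 0 ≤ ‖z * x‖ ^ 2 - ‖y‖ ^ 2 := by nlinarith [norm_nonneg y]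
      have := key (z * x) y
      have h5 := mul_nonneg h3 h4
      rw [← mul_assoc, ← mul_assoc] at this
      linarith
    · refine mul_ne_zero (inv_ne_zero (by exact_mod_cast d.succ_ne_zero)) fun h => ?_
      have h3 : ((b : ℂ) + (d + 1)) * (z * x) = -(b * y) := by linear_combination h
      have h4 := congrArg norm h3
      rw [norm_neg, norm_mul, norm_mul (b : ℂ)] at h4
      have e2 : ‖(b : ℂ)‖ = b := by rw [Complex.norm_real, Real.norm_of_nonneg hb.le]
      rw [norm_add_natCast hb, e2] at h4
      nlinarith [norm_nonneg y]

lemma szegoPair_degree (hb : 0 < b) (d : ℕ) :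
    (szegoPair b d).1.natDegree ≤ d ∧ (szegoPair b d).2.natDegree ≤ d ∧
      (szegoPair b d).1.coeff d ≠ 0 := by
  induction d with
  | zero => simp [szegoPair]
  | succ d ih =>
    obtain ⟨h1, h2, h3⟩ := ih
    have hX (c : ℂ) : (C c * X * (szegoPair b d).1).natDegree ≤ d + 1 := by
      rw [mul_assoc]
      refine (natDegree_C_mul_le _ _).trans (natDegree_mul_le.trans ?_)
      rw [natDegree_X]; omega
    have hY (c : ℂ) : (C c * (szegoPair b d).2).natDegree ≤ d + 1 :=
      (natDegree_C_mul_le _ _).trans (by omega)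
    refine ⟨(natDegree_C_mul_le _ _).trans (natDegree_add_le_of_degree_le (hX _) (hY _)),
      (natDegree_C_mul_le _ _).trans (natDegree_add_le_of_degree_le (hY _) (hX _)), ?_⟩
    simp only [szegoPair, coeff_C_mul, coeff_add, mul_assoc, coeff_X_mul]
    rw [coeff_eq_zero_of_natDegree_lt (show (szegoPair b d).2.natDegree < d + 1 by omega)]
    refine mul_ne_zero (inv_ne_zero (by exact_mod_cast d.succ_ne_zero)) ?_
    rw [mul_zero, add_zero]
    refine mul_ne_zero ?_ h3
    have : b + (d + 1) ≠ 0 := by positivity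
    exact_mod_cast this

lemma natDegree_extremalPoly (hb : 0 < b) (d : ℕ) : (extremalPoly b d).natDegree = d + 1 := by
  obtain ⟨h1, h2, h3⟩ := szegoPair_degree hb d
  refine natDegree_eq_of_le_of_coeff_ne_zero ?_ ?_
  · refine natDegree_add_le_of_degree_le (natDegree_mul_le.trans ?_)
      ((natDegree_C_mul_le _ _).trans (by omega))
    have : (C (b + (d + 1) : ℂ) * X - C (d + 1 : ℂ)).natDegree ≤ 1 :=
      natDegree_sub_le_of_le ((natDegree_C_mul_le _ _).trans natDegree_X_le)
        ((natDegree_C _).le.trans zero_le_one)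
    omega
  · simp only [extremalPoly, coeff_add, sub_mul, coeff_sub, coeff_C_mul, mul_assoc, coeff_X_mul]
    rw [coeff_eq_zero_of_natDegree_lt (show (szegoPair b d).2.natDegree < d + 1 by omega),
      coeff_eq_zero_of_natDegree_lt (show (szegoPair b d).1.natDegree < d + 1 by omega)]
    rw [mul_zero, mul_zero, add_zero, sub_zero]
    refine mul_ne_zero ?_ h3
    have : b + (d + 1) ≠ 0 := by positivity
    exact_mod_cast this

lemma eval_szegoPair_one (b : ℝ) (d : ℕ) :
    (szegoPair b d).2.eval 1 = (szegoPair b d).1.eval 1 := by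
  induction d with
  | zero => simp [szegoPair]
  | succ d ih =>
    simp only [szegoPair, eval_mul, eval_add, eval_C, eval_X]
    rw [ih]
    ring

/-- At a root with `|z| ≥ 1`, `(b + d + 1) z = (d + 1) - b u` for `u = y / x` in the closed disk.
The triangle inequality must be an equality, so `u = -1` and `z = 1`; but at 1 the two polynomials
agree, giving `u = 1`. -/
lemma norm_lt_one_of_isRoot_extremalPoly (hb : 0 < b) {d : ℕ} {z : ℂ}
    (hz : (extremalPoly b d).IsRoot z) : ‖z‖ < 1 := by
  by_contra! h
  obtain ⟨h1, h2⟩ := norm_eval_szegoPair hb d h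
  have h3 : ((b + (d + 1)) * z - (d + 1)) * (szegoPair b d).1.eval z +
      b * (szegoPair b d).2.eval z = 0 := by
    simpa [extremalPoly] using hz
  have e1 := eval_szegoPair_one b d
  by_cases hz1 : z = 1
  · subst hz1
    rw [e1] at h3
    have : (b : ℂ) * (szegoPair b d).1.eval 1 = 0 := by linear_combination h3 / 2
    exact mul_ne_zero (by exact_mod_cast hb.ne') h2 this
  set x := (szegoPair b d).1.eval z
  set y := (szegoPair b d).2.eval z
  have hx := norm_pos_iff.2 h2
  have e2 : ‖(b : ℂ)‖ = b := by rw [Complex.norm_real, Real.norm_of_nonneg hb.le]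
  have hd : ‖(d + 1 : ℂ)‖ = d + 1 := by exact_mod_cast Complex.norm_natCast (d + 1)
  set u := y / x with hu
  have hu1 : ‖u‖ ≤ 1 := by rw [hu, norm_div]; exact (div_le_one hx).2 h1
  have h4 : ((b : ℂ) + (d + 1)) * z = (d + 1) - b * u := by
    rw [hu]; field_simp; linear_combination h3
  have hd0 : (0 : ℝ) ≤ d := d.cast_nonneg
  have h5 := congrArg norm h4
  rw [norm_mul, norm_add_natCast hb] at h5
  have h6 : ‖(d + 1 : ℂ) - b * u‖ ^ 2 = (d + 1) ^ 2 - 2 * (d + 1) * b * u.re + b ^ 2 * ‖u‖ ^ 2 := by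
    rw [← Complex.normSq_eq_norm_sq, ← Complex.normSq_eq_norm_sq, Complex.normSq_apply,
      Complex.normSq_apply]
    simp
    ring
  have h7 : -u.re ≤ ‖u‖ := by
    have := Complex.abs_re_le_norm u
    linarith [neg_abs_le u.re]
  have h8 : (b + (d + 1)) ^ 2 ≤ ‖(d + 1 : ℂ) - b * u‖ ^ 2 := by
    rw [← h5]
    have : b + (d + 1) ≤ (b + (d + 1)) * ‖z‖ := by nlinarith
    have : 0 < b + (d + 1) := by positivity
    nlinarith
  rw [h6] at h8
  have hre : u.re = -1 := by
    have : ‖u‖ ^ 2 ≤ 1 := by nlinarith [norm_nonneg u]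
    have hle : u.re ≤ -1 := by
      by_contra! hlt
      have : 0 < (d + 1) * b := by positivity
      nlinarith [sq_nonneg b]
    linarith
  have him : u.im = 0 := by
    have h9 : ‖u‖ ^ 2 = u.re ^ 2 + u.im ^ 2 := by
      rw [← Complex.normSq_eq_norm_sq, Complex.normSq_apply]; ring
    have : ‖u‖ ^ 2 ≤ 1 := by nlinarith [norm_nonneg u]
    rw [hre] at h9
    nlinarith
  have hu' : u = -1 := Complex.ext (by simpa using hre) (by simpa using him)
  apply hz1
  have hne : ((b : ℂ) + (d + 1)) ≠ 0 := by
    rw [← norm_ne_zero_iff, norm_add_natCast hb]; positivity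
  apply mul_left_cancel₀ hne
  rw [h4, hu']
  ring

end

/-! ### The Poisson sum of the zeros of a polynomial -/

lemma exists_eq_C_mul_prod {p : ℂ[X]} {n : ℕ} (hp : p.natDegree = n) :
    ∃ a : Fin n → ℂ, p = C p.leadingCoeff * ∏ k, (X - C (a k)) := by
  have hspl : p.Splits := IsAlgClosed.splits p
  have hcard := hspl.natDegree_eq_card_roots
  have hprod := hspl.eq_prod_roots
  generalize p.roots = s at hcard hprod
  induction s using Quotient.inductionOn with
  | h l =>
    have hl : l.length = n := by rw [← hp, hcard]; rfl
    subst hl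
    refine ⟨l.get, ?_⟩
    conv_lhs => rw [hprod]
    congr 1
    rw [← List.prod_ofFn]
    exact congrArg List.prod (List.ofFn_getElem_eq_map l fun x => X - C x).symm

section

variable {n : ℕ} {a : Fin n → ℂ}

/-- Each kernel is `2 Re (z / (z - a)) - 1`, and the `z / (z - a k)` add up to `z p' / p`. -/
lemma poissonSum_eq_add_conj (ha : ∀ k, ‖a k‖ < 1) {z : ℂ} (hz : ‖z‖ = 1) {p : ℂ[X]}
    (hp0 : p ≠ 0) (hp : p = C p.leadingCoeff * ∏ k, (X - C (a k))) :
    (poissonSum a z : ℂ) = z * (derivative p).eval z / p.eval z +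
      conj (z * (derivative p).eval z / p.eval z) - n := by
  have h1 k := sub_ne_zero_of_norm (ha k) hz.ge
  have hP : ∏ k, (z - a k) ≠ 0 := Finset.prod_ne_zero_iff.2 fun k _ => h1 k
  have hl : p.leadingCoeff ≠ 0 := leadingCoeff_ne_zero.2 hp0
  have hfun : (fun z => p.eval z) = fun z => p.leadingCoeff * ∏ k, (z - a k) := by
    ext z
    conv_lhs => rw [hp]
    simp [eval_prod]
  have hlog : (derivative p).eval z / p.eval z = ∑ k, 1 / (z - a k) := by
    rw [← logDeriv_prod_sub h1, ← logDeriv_const_mul z _ hl, ← hfun, logDeriv_apply,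
      Polynomial.deriv]
  rw [mul_div_assoc, hlog, poissonSum, Complex.ofReal_sum, Finset.mul_sum, map_sum,
    ← Finset.sum_add_distrib]
  have hn : (n : ℂ) = ∑ _k : Fin n, 1 := by simp
  rw [hn, ← Finset.sum_sub_distrib]
  refine Finset.sum_congr rfl fun k _ => ?_
  rw [poissonKernel_eq (ha k) hz]
  have h2 := one_sub_conj_mul_ne_zero (ha k) hz.le
  have h3 := mul_conj_eq_one hz
  have h4 : conj z - conj (a k) ≠ 0 := by
    rw [← map_sub]; exact (_root_.map_ne_zero _).2 (h1 k)
  have h5 := h1 k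
  simp only [map_mul, map_div₀, map_one, map_sub]
  have h6 : 1 - conj (a k) * z = z * (conj z - conj (a k)) := by linear_combination -h3
  have hz0 := ne_zero_of_norm_eq_one hz
  rw [h6]
  field_simp
  ring

end

/-! ### The extremal Blaschke products -/

open Polynomial ComplexConjugate

section

variable {b : ℝ}

lemma extremal_identity (b d x y z : ℂ) {A B : ℂ} (hz : 1 - z ≠ 0)
    (hA : A = ((b + (d + 1)) * z - (d + 1)) * x + b * y)
    (hB : B = ((b + (d + 1)) - (d + 1) * z) * y + b * z * x) (hA0 : A ≠ 0) (hB0 : B ≠ 0) :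
    ((1 - z) * (b + (d + 1)) * z * x +
        ((b + (d + 1)) * z - (d + 1)) * ((d * (1 - z) + b) * x - b * y) +
        b * b * z * (y - x)) / ((1 - z) * A) +
      -((z - 1) * (b + (d + 1)) * y +
        ((b + (d + 1)) - (d + 1) * z) * ((d * (z - 1) + b * z) * y - b * z * x) +
        b * b * z * (x - y)) / ((1 - z) * B) - (d + 1) =
      d + b + b * (1 - b) * (b + (d + 1)) * (z * x + y) ^ 2 / (A * B) := by
  field_simp
  subst hA hB
  ring

lemma eval_extremalPoly (b : ℝ) (d : ℕ) (z : ℂ) :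
    (extremalPoly b d).eval z = ((b + (d + 1)) * z - (d + 1)) * (szegoPair b d).1.eval z +
      b * (szegoPair b d).2.eval z := by
  simp [extremalPoly]

lemma eval_derivative_extremalPoly (b : ℝ) (d : ℕ) (z : ℂ) :
    (derivative (extremalPoly b d)).eval z = (b + (d + 1)) * (szegoPair b d).1.eval z +
      ((b + (d + 1)) * z - (d + 1)) * (derivative (szegoPair b d).1).eval z +
      b * (derivative (szegoPair b d).2).eval z := by
  simp only [extremalPoly, derivative_mul, derivative_add, derivative_sub, derivative_C,
    derivative_X, eval_mul, eval_add, eval_sub, eval_C, eval_X, zero_mul, mul_one, zero_add,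
    sub_zero]

lemma poissonSum_extremal (hb : 0 < b) (d : ℕ) {z : ℂ} (hz : ‖z‖ = 1) (hz1 : z ≠ 1) :
    z * (derivative (extremalPoly b d)).eval z / (extremalPoly b d).eval z +
        conj (z * (derivative (extremalPoly b d)).eval z / (extremalPoly b d).eval z) - (d + 1) =
      (d + b + b * (1 - b) * (b + (d + 1)) *
        (‖z * (szegoPair b d).1.eval z + (szegoPair b d).2.eval z‖ ^ 2 /
          ‖(extremalPoly b d).eval z‖ ^ 2) : ℝ) := by
  have hzz := mul_conj_eq_one hz
  have hA0 : (extremalPoly b d).eval z ≠ 0 := fun h =>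
    absurd (norm_lt_one_of_isRoot_extremalPoly hb h) (by rw [hz]; exact lt_irrefl 1)
  have hA := eval_extremalPoly b d z
  have hA' := eval_derivative_extremalPoly b d z
  obtain ⟨r1, r2⟩ := szegoPair_relations b d z
  obtain ⟨hy, hx⟩ := eval_szegoPair_snd b d hz
  set A := (extremalPoly b d).eval z
  set A' := (derivative (extremalPoly b d)).eval z
  set x := (szegoPair b d).1.eval z
  set y := (szegoPair b d).2.eval z
  set x' := (derivative (szegoPair b d).1).eval z
  set y' := (derivative (szegoPair b d).2).eval z
  set w := conj z with hw
  have hwd : w ^ d * z ^ d = 1 := by rw [← mul_pow, mul_comm w, hzz, one_pow]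
  have hcx : conj x = w ^ d * y := by linear_combination (-conj x) * hwd - w ^ d * hy
  have hcy : conj y = w ^ d * x := by linear_combination (-conj y) * hwd - w ^ d * hx
  have hd1 : 1 - z ≠ 0 := sub_ne_zero.2 hz1.symm
  -- `B` is the value at `z` of the reversed extremal polynomial: `conj A` is `B` up to a power of
  -- `conj z`.
  set B : ℂ := ((b + (d + 1)) - (d + 1) * z) * y + b * z * x with hB
  have hcA : conj A = w ^ (d + 1) * B := by
    rw [hA]
    simp only [map_add, map_mul, map_sub, map_one, map_natCast, Complex.conj_ofReal, hcx, hcy, hB]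
    rw [← hw, pow_succ]
    linear_combination (-w ^ d * (b * x - (d + 1) * y)) * hzz
  have hB0 : B ≠ 0 := by
    intro h
    rw [h, mul_zero] at hcA
    exact hA0 ((map_eq_zero (starRingEnd ℂ)).1 hcA)
  have hw0 : w ≠ 0 := fun h => by rw [h, mul_zero] at hzz; exact zero_ne_one hzz
  have s1 : (1 - z) * (z * x') = (d * (1 - z) + b) * x - b * y := by
    linear_combination r1 - z * r2
  have s2 : (1 - z) * y' = b * (y - x) := by linear_combination r2 - r1
  have e1 : (1 - z) * (z * A') = (1 - z) * (b + (d + 1)) * z * x +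
      ((b + (d + 1)) * z - (d + 1)) * ((d * (1 - z) + b) * x - b * y) +
      b * b * z * (y - x) := by
    rw [hA']
    linear_combination ((b + (d + 1)) * z - (d + 1)) * s1 + b * z * s2
  have e2 : z * A' / A = ((1 - z) * (b + (d + 1)) * z * x +
      ((b + (d + 1)) * z - (d + 1)) * ((d * (1 - z) + b) * x - b * y) +
      b * b * z * (y - x)) / ((1 - z) * A) := by
    rw [← e1, mul_div_mul_left _ _ hd1]
  have e3 : conj (z * A' / A) = -((z - 1) * (b + (d + 1)) * y +
        ((b + (d + 1)) - (d + 1) * z) * ((d * (z - 1) + b * z) * y - b * z * x) +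
        b * b * z * (x - y)) / ((1 - z) * B) := by
    rw [e2, map_div₀, map_mul, hcA]
    simp only [map_add, map_mul, map_sub, map_one, map_natCast, Complex.conj_ofReal, hcx, hcy]
    rw [← hw]
    have hw1 : 1 - w = -(w * (1 - z)) := by linear_combination -hzz
    have hz0 := ne_zero_of_norm_eq_one hz
    have hwz : w = z⁻¹ := eq_inv_of_mul_eq_one_right hzz
    rw [hw1, pow_succ, hwz]
    field_simp
    ring
  have e4 : ((‖z * x + y‖ ^ 2 / ‖A‖ ^ 2 : ℝ) : ℂ) = (z * x + y) ^ 2 / (A * B) := by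
    rw [Complex.ofReal_div, ofReal_norm_sq, ofReal_norm_sq, hcA, map_add, map_mul, hcx, hcy, ← hw]
    have h : w * (w ^ d * y) + w ^ d * x = w ^ (d + 1) * (z * x + y) := by
      rw [pow_succ]
      linear_combination (-w ^ d * x) * hzz
    rw [h]
    have := pow_ne_zero (d + 1) hw0
    field_simp
  have e5 := extremal_identity (b : ℂ) d x y z hd1 hA hB hA0 hB0
  rw [e3, e2, e5, Complex.ofReal_add, Complex.ofReal_mul, e4]
  push_cast
  ring

lemma poissonSum_extremal_one (hb : 0 < b) (d : ℕ) :
    (1 : ℂ) * (derivative (extremalPoly b d)).eval 1 / (extremalPoly b d).eval 1 +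
      conj (1 * (derivative (extremalPoly b d)).eval 1 / (extremalPoly b d).eval 1) - (d + 1) =
      ((d + 1) / b : ℝ) := by
  have hx := (norm_eval_szegoPair hb d (z := 1) (by simp)).2
  have hb0 : (b : ℂ) ≠ 0 := by exact_mod_cast hb.ne'
  have h : (1 : ℂ) * (derivative (extremalPoly b d)).eval 1 / (extremalPoly b d).eval 1 =
      (((b + (d + 1)) + b * d) / (2 * b) : ℝ) := by
    have r1 := (szegoPair_relations b d 1).1
    rw [eval_extremalPoly, eval_derivative_extremalPoly]
    rw [eval_szegoPair_one] at r1 ⊢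
    have hne : ((b + (d + 1)) * 1 - (d + 1)) * (szegoPair b d).1.eval 1 +
        b * (szegoPair b d).1.eval 1 ≠ 0 := by
      have : ((b + (d + 1)) * 1 - (d + 1)) * (szegoPair b d).1.eval 1 +
        b * (szegoPair b d).1.eval 1 = 2 * b * (szegoPair b d).1.eval 1 := by ring
      rw [this]
      exact mul_ne_zero (mul_ne_zero two_ne_zero hb0) hx
    push_cast
    rw [div_eq_div_iff hne (mul_ne_zero two_ne_zero hb0)]
    linear_combination 2 * (b : ℂ) * b * r1
  rw [h, Complex.conj_ofReal]
  push_cast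
  field_simp
  ring

lemma exists_extremal (hb : 0 < b) (d : ℕ) :
    ∃ a : Fin (d + 1) → ℂ, (∀ k, ‖a k‖ < 1) ∧ poissonSum a 1 = (d + 1) / b ∧
      (b ≤ 1 → ∀ z : ℂ, ‖z‖ = 1 → d + b ≤ poissonSum a z) ∧
      (1 ≤ b → ∀ z : ℂ, ‖z‖ = 1 → poissonSum a z ≤ d + b) := by
  obtain ⟨a, ha⟩ := exists_eq_C_mul_prod (natDegree_extremalPoly hb d)
  have hp0 : extremalPoly b d ≠ 0 := by
    intro h
    have := natDegree_extremalPoly hb d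
    rw [h] at this
    simp at this
  have ha1 : ∀ k, ‖a k‖ < 1 := by
    intro k
    refine norm_lt_one_of_isRoot_extremalPoly hb (d := d) ?_
    rw [ha]
    simp only [IsRoot, eval_mul, eval_prod]
    rw [Finset.prod_eq_zero (Finset.mem_univ k) (by simp), mul_zero]
  have h1 : poissonSum a 1 = (d + 1) / b := by
    have := poissonSum_eq_add_conj ha1 (z := 1) (by simp) hp0 ha
    rw [Nat.cast_add, Nat.cast_one, poissonSum_extremal_one hb] at this
    exact_mod_cast this
  have hz {z : ℂ} (hz : ‖z‖ = 1) (hz1 : z ≠ 1) := poissonSum_eq_add_conj ha1 hz hp0 ha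
  simp only [Nat.cast_add, Nat.cast_one] at hz
  -- The value at 1 also differs from `d + b` by a nonnegative multiple of `1 - b`, so the sign of
  -- `1 - b` decides both cases below.
  have hb1 : ((d : ℝ) + 1) / b = d + b + (1 - b) * ((d + 1 + b) / b) := by
    field_simp
    ring
  have hpos : 0 ≤ ((d : ℝ) + 1 + b) / b := by positivity
  have hpos' : 0 ≤ b * (b + ((d : ℝ) + 1)) := by positivity
  refine ⟨a, ha1, h1, fun hle z hz0 => ?_, fun hle z hz0 => ?_⟩
  all_goals
    by_cases hz1 : z = 1
    · subst hz1
      rw [h1, hb1]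
      nlinarith
    · have := hz hz0 hz1
      rw [poissonSum_extremal hb d hz0 hz1, Complex.ofReal_inj] at this
      rw [this]
      have hq : 0 ≤ ‖z * (szegoPair b d).1.eval z + (szegoPair b d).2.eval z‖ ^ 2 /
        ‖(extremalPoly b d).eval z‖ ^ 2 := by positivity
      have := mul_nonneg hpos' hq
      nlinarith

/-- Take `b = M - d ≥ 1`, so that `d + b = M` bounds the sum above. The necessary inequality between
the extreme values then forces the supremum up to `M`. -/
lemma exists_minimal (d : ℕ) {M : ℝ} (hM : (d : ℝ) + 1 ≤ M) :
    ∃ a : Fin (d + 1) → ℂ, (∀ k, ‖a k‖ < 1) ∧ poissonSup a = M ∧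
      poissonInf a ≤ (d + 1) / (M - d) := by
  have hb : 0 < M - d := by linarith
  obtain ⟨a, ha, h1, -, h⟩ := exists_extremal hb d
  have hle : poissonSup a ≤ M := poissonSup_le fun z hz => by
    linarith [h (by linarith) z hz]
  have hinf : poissonInf a ≤ (d + 1) / (M - d) := by
    rw [← h1]
    exact poissonInf_le_poissonSum ha (by simp)
  refine ⟨a, ha, le_antisymm hle ?_, hinf⟩
  have h2 := natCast_le_poissonInf_mul ha
  have h3 := natCast_le_poissonSup ha
  push_cast at h2 h3
  have h4 : (d + 1 : ℝ) ≤ (d + 1) / (M - d) * (poissonSup a - d) := by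
    refine h2.trans ?_
    have := mul_le_mul_of_nonneg_right hinf (show 0 ≤ poissonSup a - d by linarith)
    linarith
  rw [div_mul_eq_mul_div, le_div_iff₀ hb] at h4
  have h5 : (0 : ℝ) < d + 1 := by positivity
  linarith [le_of_mul_le_mul_left h4 h5]

/-- Take `b = (d + 1) / M ≤ 1`, so that the value at 1 is `M`. The lower bound `d + b` and the
necessary inequality keep the supremum from exceeding `M`. -/
lemma exists_maximal (d : ℕ) {M : ℝ} (hM : (d : ℝ) + 1 ≤ M) :
    ∃ a : Fin (d + 1) → ℂ, (∀ k, ‖a k‖ < 1) ∧ poissonSup a = M ∧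
      d + (d + 1) / M ≤ poissonInf a := by
  have hd : (0 : ℝ) < d + 1 := by positivity
  have hM0 : 0 < M := by linarith
  have hb : 0 < (d + 1) / M := by positivity
  obtain ⟨a, ha, h1, h, -⟩ := exists_extremal hb d
  have hinf : d + (d + 1) / M ≤ poissonInf a := le_poissonInf (h ((div_le_one hM0).2 hM))
  have h2 : poissonSum a 1 = M := by rw [h1]; field_simp
  refine ⟨a, ha, le_antisymm ?_ ?_, hinf⟩
  · have h3 := poissonSup_mul_le_natCast ha
    have h4 := poissonSup_nonneg ha
    push_cast at h3
    have h5 : poissonSup a * ((d + 1) / M) ≤ d + 1 := by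
      refine le_trans (mul_le_mul_of_nonneg_left ?_ h4) h3
      linarith
    rw [mul_div_assoc', div_le_iff₀ hM0] at h5
    rw [mul_comm] at h5
    exact le_of_mul_le_mul_left h5 hd
  · rw [← h2]
    exact poissonSum_le_poissonSup ha (by simp)

end

/-! ### Continuity in the zeros and monotonicity along rays -/

open ComplexConjugate Topology

section

variable {n : ℕ}

lemma continuous_uncurry_poissonSum : Continuous
    fun p : Metric.ball (0 : Fin n → ℂ) 1 × Metric.sphere (0 : ℂ) 1 =>
      poissonSum (p.1 : Fin n → ℂ) p.2 := by
  unfold poissonSum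
  refine continuous_finsetSum _ fun k _ => ?_
  have h1 : Continuous fun p : Metric.ball (0 : Fin n → ℂ) 1 × Metric.sphere (0 : ℂ) 1 =>
      (p.1 : Fin n → ℂ) k := (continuous_apply k).comp (continuous_subtype_val.comp continuous_fst)
  refine Continuous.div (by fun_prop) (by fun_prop) ?_
  rintro ⟨⟨a, ha⟩, ⟨z, hz⟩⟩
  have := norm_ne_zero_iff.2 (sub_ne_zero_of_norm (a := a k)
    ((norm_le_pi_norm a k).trans_lt (mem_ball_zero_iff.1 ha)) (mem_sphere_zero_iff_norm.1 hz).ge)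
  positivity

lemma image_sphere_eq (f : ℂ → ℝ) : f '' Metric.sphere (0 : ℂ) 1 =
    (fun z : Metric.sphere (0 : ℂ) 1 => f z) '' Set.univ := by
  rw [Set.image_univ, Set.image_eq_range]

lemma continuous_poissonSup :
    Continuous fun a : Metric.ball (0 : Fin n → ℂ) 1 => poissonSup (a : Fin n → ℂ) := by
  simp only [poissonSup, image_sphere_eq]
  exact isCompact_univ.continuous_sSup continuous_uncurry_poissonSum

lemma continuous_poissonInf :
    Continuous fun a : Metric.ball (0 : Fin n → ℂ) 1 => poissonInf (a : Fin n → ℂ) := by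
  simp only [poissonInf, image_sphere_eq]
  exact isCompact_univ.continuous_sInf continuous_uncurry_poissonSum

lemma smul_mem_ball_of_norm_eq_one {e : Fin n → ℂ} (he : ‖e‖ = 1) {r : ℝ} (hr0 : 0 ≤ r)
    (hr1 : r < 1) : r • e ∈ Metric.ball (0 : Fin n → ℂ) 1 := by
  rw [mem_ball_zero_iff, norm_smul, he, mul_one, Real.norm_of_nonneg hr0]
  exact hr1

lemma norm_apply_lt_one_of_mem_ball {a : Fin n → ℂ} (ha : a ∈ Metric.ball (0 : Fin n → ℂ) 1)
    (k : Fin n) : ‖a k‖ < 1 :=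
  (norm_le_pi_norm a k).trans_lt (mem_ball_zero_iff.1 ha)

lemma exists_norm_apply_eq_one {e : Fin n → ℂ} (he : ‖e‖ = 1) : ∃ k, ‖e k‖ = 1 := by
  by_contra! h
  have : ‖e‖ < 1 := (pi_norm_lt_iff one_pos).2 fun k =>
    lt_of_le_of_ne ((norm_le_pi_norm e k).trans he.le) (h k)
  linarith

lemma poissonSum_zero {z : ℂ} (hz : ‖z‖ = 1) : poissonSum (0 : Fin n → ℂ) z = n := by
  simp [poissonSum, hz]

lemma le_poissonSum_smul {e : Fin n → ℂ} (he : ‖e‖ = 1) {r : ℝ} (hr0 : 0 ≤ r) (hr1 : r < 1)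
    {k : Fin n} (hk : ‖e k‖ = 1) : (1 + r) / (1 - r) ≤ poissonSum (r • e) (e k) := by
  have hr : 0 < 1 - r := by linarith
  have hpos : ∀ j ∈ Finset.univ, 0 ≤ (1 - ‖(r • e) j‖ ^ 2) / ‖e k - (r • e) j‖ ^ 2 := by
    intro j _
    have := norm_apply_lt_one_of_mem_ball (smul_mem_ball_of_norm_eq_one he hr0 hr1) j
    refine div_nonneg ?_ (sq_nonneg _)
    nlinarith [norm_nonneg ((r • e) j)]
  refine le_trans (le_of_eq ?_) (Finset.single_le_sum hpos (Finset.mem_univ k))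
  have h1 : e k - (r • e) k = ((1 - r : ℝ) : ℂ) * e k := by
    rw [Pi.smul_apply, Complex.real_smul]; push_cast; ring
  rw [h1, norm_mul, hk, Pi.smul_apply, norm_smul, hk, Complex.norm_real, Real.norm_of_nonneg hr.le,
    Real.norm_of_nonneg hr0]
  field_simp
  ring

lemma re_one_add_div_one_sub {u : ℂ} (hu : u ≠ 1) :
    ((1 + u) / (1 - u)).re = (1 - ‖u‖ ^ 2) / ‖1 - u‖ ^ 2 := by
  have h : 1 - u ≠ 0 := sub_ne_zero.2 hu.symm
  have h' : 1 - conj u ≠ 0 := by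
    have := (_root_.map_ne_zero (starRingEnd ℂ)).2 h
    rwa [map_sub, map_one] at this
  apply Complex.ofReal_injective
  rw [Complex.re_eq_add_conj, Complex.ofReal_div, Complex.ofReal_sub, ofReal_norm_sq,
    ofReal_norm_sq, map_div₀, map_add, map_sub, map_one, Complex.ofReal_one]
  field_simp
  ring

/-- A holomorphic function whose real part on a circle about the origin is `poissonSum` of the
corresponding multiple of `e`. -/
noncomputable def herglotzSum (e : Fin n → ℂ) (w : ℂ) : ℂ :=
  ∑ k, (1 + e k * w) / (1 - e k * w)

lemma mul_apply_ne_one {e : Fin n → ℂ} (he : ‖e‖ = 1) {w : ℂ} (hw : ‖w‖ < 1) (k : Fin n) :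
    e k * w ≠ 1 := by
  intro h
  have h1 := congrArg norm h
  rw [norm_mul, norm_one] at h1
  nlinarith [(norm_le_pi_norm e k).trans he.le, norm_nonneg (e k), norm_nonneg w]

/-- Radius and angle merge into one holomorphic variable `w = r * conj z`, so scaling the zeros
becomes moving between circles. -/
lemma poissonSum_smul_eq_re {e : Fin n → ℂ} (he : ‖e‖ = 1) {r : ℝ} (hr0 : 0 ≤ r) (hr1 : r < 1)
    {z : ℂ} (hz : ‖z‖ = 1) : poissonSum (r • e) z = (herglotzSum e (r * conj z)).re := by
  have hw : ‖(r : ℂ) * conj z‖ < 1 := by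
    rw [norm_mul, Complex.norm_conj, hz, Complex.norm_real, Real.norm_of_nonneg hr0]; linarith
  rw [poissonSum, herglotzSum, Complex.re_sum]
  refine Finset.sum_congr rfl fun k _ => ?_
  rw [re_one_add_div_one_sub (mul_apply_ne_one he hw k)]
  have h1 : 1 - e k * (r * conj z) = conj z * (z - (r • e) k) := by
    rw [Pi.smul_apply, Complex.real_smul]
    linear_combination -mul_conj_eq_one hz
  have h2 : ‖e k * (r * conj z)‖ = ‖(r • e) k‖ := by
    rw [Pi.smul_apply, Complex.real_smul, norm_mul, norm_mul, norm_mul, Complex.norm_conj, hz]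
    ring
  rw [h1, h2, norm_mul, Complex.norm_conj, hz, one_mul]

lemma differentiableOn_exp_herglotzSum {e : Fin n → ℂ} (he : ‖e‖ = 1) :
    DifferentiableOn ℂ (fun w => Complex.exp (herglotzSum e w)) (Metric.ball 0 1) := by
  unfold herglotzSum
  refine DifferentiableOn.cexp (DifferentiableOn.fun_sum fun k _ => DifferentiableOn.div
    (by fun_prop) (by fun_prop) fun w hw => ?_)
  exact sub_ne_zero.2 (mul_apply_ne_one he (mem_ball_zero_iff.1 hw) k).symm

lemma exp_herglotzSum_not_const {e : Fin n → ℂ} (he : ‖e‖ = 1) {c : ℂ} :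
    ¬ ∀ w ∈ Metric.ball (0 : ℂ) 1, Complex.exp (herglotzSum e w) = c := by
  intro h
  obtain ⟨k, hk⟩ := exists_norm_apply_eq_one he
  have hn : (0 : ℝ) ≤ n := n.cast_nonneg
  have h0 := h 0 (by simp)
  -- Chosen so that `(1 + r) / (1 - r) = 2 n + 1`, which exceeds the real part `n` at 0.
  set r : ℝ := n / (n + 1) with hr
  have hr0 : 0 ≤ r := by positivity
  have hr1 : r < 1 := by rw [hr, div_lt_one (by linarith)]; linarith
  have h1 := h (r * conj (e k)) (by
    rw [mem_ball_zero_iff, norm_mul, Complex.norm_conj, hk, Complex.norm_real,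
      Real.norm_of_nonneg hr0]
    linarith)
  rw [← h0] at h1
  have h2 := congrArg norm h1
  rw [Complex.norm_exp, Complex.norm_exp, Real.exp_eq_exp,
    ← poissonSum_smul_eq_re he hr0 hr1 hk] at h2
  have h3 : (herglotzSum e 0).re = n := by simp [herglotzSum]
  have h4 := le_poissonSum_smul he hr0 hr1 hk
  have h5 : (1 + r) / (1 - r) = 2 * n + 1 := by
    rw [hr]
    field_simp
    ring
  linarith

/-- Otherwise `|exp|` of the Herglotz sum has an interior maximum on the disk of radius `s`, hence
is constant there and, by the identity theorem, on the unit disk. -/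
lemma poissonSup_smul_lt {e : Fin n → ℂ} (he : ‖e‖ = 1) {r s : ℝ} (hr : 0 ≤ r) (hrs : r < s)
    (hs : s < 1) : poissonSup (r • e) < poissonSup (s • e) := by
  by_contra! hle
  have hr1 : r < 1 := hrs.trans hs
  have hs0 : 0 < s := hr.trans_lt hrs
  obtain ⟨z₀, hz₀, h₀⟩ := exists_poissonSum_eq_poissonSup
    (norm_apply_lt_one_of_mem_ball (smul_mem_ball_of_norm_eq_one he hr hr1))
  rw [poissonSum_smul_eq_re he hr hr1 hz₀] at h₀
  have hdiff := differentiableOn_exp_herglotzSum he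
  have hsub : Metric.closedBall (0 : ℂ) s ⊆ Metric.ball 0 1 := Metric.closedBall_subset_ball hs
  have hmem : (r : ℂ) * conj z₀ ∈ Metric.ball (0 : ℂ) s := by
    rw [mem_ball_zero_iff, norm_mul, Complex.norm_conj, hz₀, Complex.norm_real,
      Real.norm_of_nonneg hr]
    linarith
  have hmax : IsMaxOn (norm ∘ fun w => Complex.exp (herglotzSum e w)) (Metric.ball 0 s)
      (r * conj z₀) := by
    intro w hw
    simp only [Set.mem_ofPred_eq, Function.comp_apply]
    refine Complex.norm_le_of_forall_mem_frontier_norm_le Metric.isBounded_ball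
      (DifferentiableOn.diffContOnCl (hdiff.mono ?_)) ?_ (subset_closure hw)
    · exact Metric.closure_ball_subset_closedBall.trans hsub
    · intro v hv
      rw [frontier_ball _ hs0.ne', mem_sphere_zero_iff_norm] at hv
      have hz : ‖conj v / s‖ = 1 := by
        rw [norm_div, Complex.norm_conj, hv, Complex.norm_real, Real.norm_of_nonneg hs0.le,
          div_self hs0.ne']
      have hvz : v = s * conj (conj v / (s : ℂ)) := by
        have : (s : ℂ) ≠ 0 := by exact_mod_cast hs0.ne'
        rw [map_div₀, Complex.conj_conj, Complex.conj_ofReal]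
        field_simp
      rw [Complex.norm_exp, Complex.norm_exp, Real.exp_le_exp, h₀, hvz,
        ← poissonSum_smul_eq_re he hs0.le hs hz]
      exact (poissonSum_le_poissonSup (norm_apply_lt_one_of_mem_ball
        (smul_mem_ball_of_norm_eq_one he hs0.le hs)) hz).trans hle
  have hconst := Complex.eqOn_of_isPreconnected_of_isMaxOn_norm
    (convex_ball (0 : ℂ) s).isPreconnected Metric.isOpen_ball
    (hdiff.mono (Metric.ball_subset_closedBall.trans hsub)) hmem hmax
  have hall := (hdiff.analyticOnNhd Metric.isOpen_ball).eqOn_of_preconnected_of_eventuallyEq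
    (g := fun _ => Complex.exp (herglotzSum e (r * conj z₀))) analyticOnNhd_const
    (convex_ball (0 : ℂ) 1).isPreconnected (Metric.mem_ball_self one_pos)
    (hconst.eventuallyEq_of_mem (Metric.ball_mem_nhds 0 hs0))
  exact exp_herglotzSum_not_const he hall

lemma poissonSup_zero : poissonSup (0 : Fin n → ℂ) = n := by
  obtain ⟨z, hz, h⟩ := exists_poissonSum_eq_poissonSup (a := (0 : Fin n → ℂ)) (by simp)
  rw [← h, poissonSum_zero hz]

lemma exists_poissonSup_smul_eq {e : Fin n → ℂ} (he : ‖e‖ = 1) {M : ℝ} (hM : (n : ℝ) ≤ M) :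
    ∃ r : ℝ, 0 ≤ r ∧ r < 1 ∧ poissonSup (r • e) = M := by
  have hM0 : 0 ≤ M := n.cast_nonneg.trans hM
  obtain ⟨k, hk⟩ := exists_norm_apply_eq_one he
  set s : ℝ := M / (M + 1) with hs
  have hs0 : 0 ≤ s := by positivity
  have hs1 : s < 1 := by rw [hs, div_lt_one (by linarith)]; linarith
  have hbig : M ≤ poissonSup (s • e) := by
    refine le_trans ?_ ((le_poissonSum_smul he hs0 hs1 hk).trans (poissonSum_le_poissonSup
      (norm_apply_lt_one_of_mem_ball (smul_mem_ball_of_norm_eq_one he hs0 hs1)) hk))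
    have : (1 + s) / (1 - s) = 2 * M + 1 := by
      rw [hs]
      field_simp
      ring
    linarith
  have hcont : ContinuousOn (fun r : ℝ => poissonSup (r • e)) (Set.Icc 0 s) := by
    rw [continuousOn_iff_continuous_domRestrict]
    exact continuous_poissonSup.comp (f := fun r : Set.Icc 0 s =>
      (⟨(r : ℝ) • e, smul_mem_ball_of_norm_eq_one he r.2.1 (r.2.2.trans_lt hs1)⟩ :
        Metric.ball (0 : Fin n → ℂ) 1)) (by fun_prop)
  obtain ⟨r, hr, h⟩ := intermediate_value_Icc hs0 hcont
    (show M ∈ Set.Icc _ _ by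
      refine ⟨?_, hbig⟩
      simpa only [zero_smul, poissonSup_zero] using hM)
  exact ⟨r, hr.1, hr.2.trans_lt hs1, h⟩

/-! ### The level set of the supremum as a radial graph -/

/-- By monotonicity `s < r e` means that the supremum at `s • e` is below `M`, an open condition on
`e` for fixed `s`; likewise for `r e < s`. -/
lemma continuous_radius {M : ℝ} {r : Metric.sphere (0 : Fin n → ℂ) 1 → ℝ} (hr0 : ∀ e, 0 ≤ r e)
    (hr1 : ∀ e, r e < 1) (hr : ∀ e, poissonSup (r e • (e : Fin n → ℂ)) = M) : Continuous r := by
  have hnorm (e : Metric.sphere (0 : Fin n → ℂ) 1) : ‖(e : Fin n → ℂ)‖ = 1 :=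
    mem_sphere_zero_iff_norm.1 e.2
  have hcont {s : ℝ} (hs0 : 0 ≤ s) (hs1 : s < 1) :
      Continuous fun e : Metric.sphere (0 : Fin n → ℂ) 1 => poissonSup (s • (e : Fin n → ℂ)) :=
    continuous_poissonSup.comp (f := fun e : Metric.sphere (0 : Fin n → ℂ) 1 =>
      (⟨s • (e : Fin n → ℂ), smul_mem_ball_of_norm_eq_one (hnorm e) hs0 hs1⟩ :
        Metric.ball (0 : Fin n → ℂ) 1)) (by fun_prop)
  have hmono (e : Metric.sphere (0 : Fin n → ℂ) 1) :
      StrictMonoOn (fun s : ℝ => poissonSup (s • (e : Fin n → ℂ))) (Set.Ico 0 1) :=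
    fun s hs t ht hst => poissonSup_smul_lt (hnorm e) hs.1 hst ht.2
  have hlt {e : Metric.sphere (0 : Fin n → ℂ) 1} {s : ℝ} (hs0 : 0 ≤ s) (hs1 : s < 1) :
      poissonSup (s • (e : Fin n → ℂ)) < M ↔ s < r e := by
    rw [← hr e]
    exact (hmono e).lt_iff_lt ⟨hs0, hs1⟩ ⟨hr0 e, hr1 e⟩
  have hgt {e : Metric.sphere (0 : Fin n → ℂ) 1} {s : ℝ} (hs0 : 0 ≤ s) (hs1 : s < 1) :
      M < poissonSup (s • (e : Fin n → ℂ)) ↔ r e < s := by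
    rw [← hr e]
    exact (hmono e).lt_iff_lt ⟨hr0 e, hr1 e⟩ ⟨hs0, hs1⟩
  refine continuous_iff_continuousAt.2 fun e₀ => tendsto_order.2 ⟨fun s hs => ?_, fun s hs => ?_⟩
  · rcases lt_or_ge s 0 with h | h
    · exact Filter.Eventually.of_forall fun e => h.trans_le (hr0 e)
    · have hs1 := hs.trans (hr1 e₀)
      filter_upwards [(hcont h hs1).continuousAt.eventually_lt_const ((hlt h hs1).2 hs)] with e he
      exact (hlt h hs1).1 he
  -- The bound `s` may be 1 or more, outside the range of the monotonicity, so a level `t < 1`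
  -- replaces it.
  · obtain ⟨t, ht, hts⟩ := exists_between (lt_min hs (hr1 e₀))
    have ht0 := (hr0 e₀).trans ht.le
    have ht1 := hts.trans_le (min_le_right _ _)
    filter_upwards [(hcont ht0 ht1).continuousAt.eventually_const_lt ((hgt ht0 ht1).2 ht)] with e he
    exact ((hgt ht0 ht1).1 he).trans (hts.trans_le (min_le_left _ _))

lemma preconnectedSpace_sphere (hn : 1 ≤ n) :
    PreconnectedSpace (Metric.sphere (0 : Fin n → ℂ) 1) := by
  refine Subtype.preconnectedSpace (isPreconnected_sphere ?_ _ _)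
  rw [← Module.finrank_eq_rank, Module.finrank_pi_fintype]
  simp only [Complex.finrank_real_complex, Finset.sum_const, Finset.card_univ, Fintype.card_fin,
    smul_eq_mul]
  exact_mod_cast (by omega : 1 < n * 2)

lemma exists_poissonSup_eq_poissonInf_eq (hn : 1 ≤ n) {m M : ℝ} (hM : (n : ℝ) < M)
    {a₀ a₁ : Fin n → ℂ} (ha₀ : ∀ k, ‖a₀ k‖ < 1) (ha₁ : ∀ k, ‖a₁ k‖ < 1)
    (hs₀ : poissonSup a₀ = M) (hs₁ : poissonSup a₁ = M) (hm₀ : poissonInf a₀ ≤ m)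
    (hm₁ : m ≤ poissonInf a₁) :
    ∃ a : Fin n → ℂ, (∀ k, ‖a k‖ < 1) ∧ poissonSup a = M ∧ poissonInf a = m := by
  have hnorm (e : Metric.sphere (0 : Fin n → ℂ) 1) : ‖(e : Fin n → ℂ)‖ = 1 :=
    mem_sphere_zero_iff_norm.1 e.2
  choose r hr0 hr1 hr using fun e : Metric.sphere (0 : Fin n → ℂ) 1 =>
    exists_poissonSup_smul_eq (hnorm e) hM.le
  have hcont := continuous_radius hr0 hr1 hr
  have hball e := smul_mem_ball_of_norm_eq_one (hnorm e) (hr0 e) (hr1 e)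
  have hg : Continuous fun e => poissonInf (r e • (e : Fin n → ℂ)) :=
    continuous_poissonInf.comp (f := fun e => (⟨_, hball e⟩ : Metric.ball (0 : Fin n → ℂ) 1))
      (by fun_prop)
  have hdir {a : Fin n → ℂ} (ha : ∀ k, ‖a k‖ < 1) (hs : poissonSup a = M) :
      ∃ e, r e • (e : Fin n → ℂ) = a := by
    -- This is where `n < M` is needed: the origin has no direction, and its supremum is `n`.
    have ha0 : a ≠ 0 := by
      rintro rfl
      rw [poissonSup_zero] at hs
      exact hM.ne hs
    have hpos := norm_pos_iff.2 ha0
    have hlt : ‖a‖ < 1 := (pi_norm_lt_iff one_pos).2 ha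
    set e : Metric.sphere (0 : Fin n → ℂ) 1 :=
      ⟨‖a‖⁻¹ • a, by
        rw [mem_sphere_zero_iff_norm, norm_smul, norm_inv, norm_norm, inv_mul_cancel₀ hpos.ne']⟩
    have hae : ‖a‖ • (e : Fin n → ℂ) = a := by
      rw [smul_smul, mul_inv_cancel₀ hpos.ne', one_smul]
    refine ⟨e, ?_⟩
    have : r e = ‖a‖ := by
      rcases lt_trichotomy (r e) ‖a‖ with h | h | h
      · have := poissonSup_smul_lt (hnorm e) (hr0 e) h hlt
        rw [hr, hae, hs] at this
        exact absurd this (lt_irrefl _)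
      · exact h
      · have := poissonSup_smul_lt (hnorm e) hpos.le h (hr1 e)
        rw [hr, hae, hs] at this
        exact absurd this (lt_irrefl _)
    rw [this, hae]
  obtain ⟨e₀, he₀⟩ := hdir ha₀ hs₀
  obtain ⟨e₁, he₁⟩ := hdir ha₁ hs₁
  have := preconnectedSpace_sphere hn
  obtain ⟨e, he⟩ := mem_range_of_exists_le_of_exists_ge hg (c := m) ⟨e₀, by rwa [he₀]⟩
    ⟨e₁, by rwa [he₁]⟩
  exact ⟨_, norm_apply_lt_one_of_mem_ball (hball e), hr e, he⟩

end

/-! ### The theorem -/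

theorem theorem1 (n : ℕ) (hn : 1 ≤ n) :
    (∀ B : ℂ → ℂ, IsBlaschkeProduct n B →
      ((n : ℝ) / (supDeriv B - n + 1) ≤ infDeriv B ∧
        infDeriv B ≤ (n : ℝ) - 1 + n / supDeriv B) ∧
      (0 < infDeriv B ∧ infDeriv B ≤ n ∧ (n : ℝ) ≤ supDeriv B)) ∧
    (∀ m M : ℝ, 0 < m → 0 < M →
      ((n : ℝ) / (M - n + 1) ≤ m ∧ m ≤ (n : ℝ) - 1 + n / M) →
      (0 < m ∧ m ≤ n ∧ (n : ℝ) ≤ M) →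
      ∃ B : ℂ → ℂ, IsBlaschkeProduct n B ∧ supDeriv B = M ∧ infDeriv B = m) := by
  have hn' : (1 : ℝ) ≤ n := by exact_mod_cast hn
  constructor
  · rintro _ ⟨α, a, hα, ha, rfl⟩
    rw [supDeriv_blaschkeProduct hα ha, infDeriv_blaschkeProduct hα ha]
    have h1 := natCast_le_poissonSup ha
    refine ⟨⟨?_, ?_⟩, poissonInf_pos hn ha, poissonInf_le_natCast ha, h1⟩
    · rw [div_le_iff₀ (by linarith)]
      exact natCast_le_poissonInf_mul ha
    · have h2 := poissonSup_mul_le_natCast ha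
      rw [mul_comm, ← le_div_iff₀ (by linarith)] at h2
      linarith
  · rintro m M hm hM ⟨h1, h2⟩ ⟨-, hmn, hnM⟩
    suffices ∃ a : Fin n → ℂ, (∀ k, ‖a k‖ < 1) ∧ poissonSup a = M ∧ poissonInf a = m by
      obtain ⟨a, ha, hs, hi⟩ := this
      have hα : ‖(1 : ℂ)‖ = 1 := norm_one
      exact ⟨blaschkeProduct 1 a, ⟨1, a, hα, ha, rfl⟩, by rw [supDeriv_blaschkeProduct hα ha, hs],
        by rw [infDeriv_blaschkeProduct hα ha, hi]⟩
    obtain ⟨d, rfl⟩ : ∃ d, n = d + 1 := ⟨n - 1, by omega⟩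
    push_cast at h1 h2 hmn hnM
    obtain ⟨a₀, ha₀, hs₀, hi₀⟩ := exists_minimal d hnM
    obtain ⟨a₁, ha₁, hs₁, hi₁⟩ := exists_maximal d hnM
    have hm₀ : poissonInf a₀ ≤ m := by
      refine hi₀.trans (le_trans (le_of_eq ?_) h1)
      congr 1
      ring
    have hm₁ : m ≤ poissonInf a₁ := by linarith
    -- If `M = n` the level set has no radial graph, but the inequalities force `m = n`.
    rcases hnM.eq_or_lt with h | h
    · refine ⟨a₁, ha₁, hs₁, le_antisymm ?_ hm₁⟩
      have h3 := poissonInf_le_natCast ha₁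
      push_cast at h3
      rw [← h] at h1
      have h4 : ((d : ℝ) + 1) / (d + 1 - (d + 1) + 1) = d + 1 := by simp
      linarith
    · exact exists_poissonSup_eq_poissonInf_eq hn (by push_cast; exact h) ha₀ ha₁ hs₀ hs₁ hm₀ hm₁
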